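/- Notation. For a real random vector $w=(w_i)_{i\in I}$ ($I$ finite) with finite moments of all orders and $i_1,\dots,i_k\in I$, the cumulant $\kappa(w_{i_1},\dots,w_{i_k})$ is the Taylor coefficient at $t=0$ of $\log\mathbb{E}[e^{\mathrm{i}\,t\cdot w}]$, that is, $\kappa(w_{i_1},\dots,w_{i_k})=\mathrm{i}^{-k}\,\partial_{t_{i_1}}\cdots\partial_{t_{i_k}}\log \mathbb{E}[e^{\mathrm{i}\,t\cdot w}]\big|_{t=0}$. For index pairs put $$d(a_1a_2,a_3a_4)=\min\{|a_1-a_3|+|a_2-a_4|,\ |a_1-a_4|+|a_2-a_3|\}.$$ For index pairs $\alpha_1,\dots,\alpha_k$, a minimal spanning tree is a spanning tree of the complete graph on the vertices $1,\dots,k$ whose total edge weight is minimal, where the edge $\{i,j\}$ has weight $d(\alpha_i,\alpha_j)$. Theorem. Fix $s>2$, constants $\mu_q$ ($q\in\mathbb{N}$), $C_\kappa>0$ and $C(k)>0$ ($k\in\mathbb{N}$). Then for every $\varepsilon>0$ and $D>0$ there is a constant $C(\varepsilon,D)$, depending only on $\varepsilon$, $D$ and the constants just listed, such that $$\mathbb{P}\big(\|H\|>N^{\varepsilon}\big)\le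 C(\varepsilon,D)\,N^{-D}$$ for every integer $N\ge 1$ and every $N\times N$ random matrix $H=W/\sqrt N$, where $\|\cdot\|$ is the operator norm with respect to the Euclidean norm, in each of the following two cases. (a) Real symmetric case: $W$ is a real symmetric random matrix and (A1) $\mathbb{E}W_{ij}=0$ for all $i,j$; (A2) $\mathbb{E}|W_{ij}|^q\le\mu_q$ for all $q\in\mathbb{N}$ and all $i,j$; (A3) with $\kappa_k(\alpha_1,\dots,\alpha_k)=\kappa(W_{\alpha_1},\dots,W_{\alpha_k})$, for all index pairs $$|\kappa_2(\alpha,\beta)|\le\frac{C_\kappa}{1+d(\alpha,\beta)^s},$$ and for all $k\ge3$ and all index pairs $\alpha_1,\dots,\alpha_k$ there is a minimal spanning tree $T_{\min}$ such that $$|\kappa_k(\alpha_1,\dots,\alpha_k)|\le C(k)\prod_{\{i,j\}\in T_{\min}}|\kappa_2(\alpha_i,\alpha_j)|.$$ (b) Complex Hermitian case: $W$ is a complex Hermitian random matrix satisfying (A1), (A2) and the following version of (A3) for the real random variables $W^{(0)}_\alpha=\operatorname{Re}W_\alpha$ and $W^{(1)}_\alpha=\operatorname{Im}W_\alpha$.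 With $\bar\kappa_2(\alpha,\beta)=\max_{\sigma,\tau\in\{0,1\}}|\kappa(W^{(\sigma)}_\alpha,W^{(\tau)}_\beta)|$, for all index pairs $$\bar\kappa_2(\alpha,\beta)\le\frac{C_\kappa}{1+d(\alpha,\beta)^s},$$ and for all $k\ge3$, all index pairs $\alpha_1,\dots,\alpha_k$ and all $\sigma_1,\dots,\sigma_k\in\{0,1\}$ there is a minimal spanning tree $T_{\min}$ such that $$|\kappa(W^{(\sigma_1)}_{\alpha_1},\dots,W^{(\sigma_k)}_{\alpha_k})|\le C(k)\prod_{\{i,j\}\in T_{\min}}\bar\kappa_2(\alpha_i,\alpha_j).$$ -/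

import Mathlib

open MeasureTheory

noncomputable section

namespace CorrelatedMatrix

/-- The cumulant `κ(w_{α 1}, …, w_{α k})` of a real random vector `w = (w_i)_{i ∈ ι}`: the Taylor
coefficient at `0` of the logarithm of the characteristic function `t ↦ 𝔼 exp(i t·w)`.  If `m i` is
the multiplicity of `i` in `α`, this is `i^{-k} ∂^m log 𝔼 exp(i t·w)` at `t = 0`, i.e. the number
`κ_m` in `log 𝔼 exp(i t·w) = ∑ κ_m (i t)^m / m!`. -/
def cumulant {Ω ι : Type*} [MeasurableSpace Ω] [Fintype ι] [DecidableEq ι]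
    (P : Measure Ω) (w : ι → Ω → ℝ) {k : ℕ} (α : Fin k → ι) : ℂ :=
  (-Complex.I) ^ k *
    iteratedFDeriv ℝ k
      (fun t : EuclideanSpace ℝ ι =>
        Complex.log (charFun (P.map fun ω => WithLp.toLp 2 fun i => w i ω) t))
      0 (fun j => EuclideanSpace.single (α j) (1 : ℝ))

/-- The distance of index pairs modulo the symmetry:
`d(a₁a₂, a₃a₄) = min {|a₁ - a₃| + |a₂ - a₄|, |a₁ - a₄| + |a₂ - a₃|}`. -/
def pairDist {N : ℕ} (α β : Fin N × Fin N) : ℝ :=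
  min (|((α.1 : ℕ) : ℝ) - ((β.1 : ℕ) : ℝ)| + |((α.2 : ℕ) : ℝ) - ((β.2 : ℕ) : ℝ)|)
    (|((α.1 : ℕ) : ℝ) - ((β.2 : ℕ) : ℝ)| + |((α.2 : ℕ) : ℝ) - ((β.1 : ℕ) : ℝ)|)

open Classical in
/-- The edges of a graph on `{1, …, k}`, each one listed once, as a pair `(i, j)` with `i < j`. -/
def edges {k : ℕ} (T : SimpleGraph (Fin k)) : Finset (Fin k × Fin k) :=
  Finset.univ.filter fun e => e.1 < e.2 ∧ T.Adj e.1 e.2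

/-- `T` is a minimal spanning tree of the complete graph on `{1, …, k}` with edge weights `c`. -/
def IsMinSpanningTree {k : ℕ} (c : Fin k → Fin k → ℝ) (T : SimpleGraph (Fin k)) : Prop :=
  T.IsTree ∧ ∀ T' : SimpleGraph (Fin k), T'.IsTree →
    ∑ e ∈ edges T, c e.1 e.2 ≤ ∑ e ∈ edges T', c e.1 e.2

/-- The entries of a real random matrix as a random vector indexed by the index pairs. -/
def realEntries {Ω : Type*} {N : ℕ} (W : Ω → Matrix (Fin N) (Fin N) ℝ) :
    Fin N × Fin N → Ω → ℝ :=
  fun a ω => W ω a.1 a.2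

/-- The real parts (label `false`) and imaginary parts (label `true`) of the entries of a complex
random matrix, as one real random vector. -/
def complexEntries {Ω : Type*} {N : ℕ} (W : Ω → Matrix (Fin N) (Fin N) ℂ) :
    (Fin N × Fin N) × Bool → Ω → ℝ :=
  fun a ω => if a.2 then (W ω a.1.1 a.1.2).im else (W ω a.1.1 a.1.2).re

/-- The size of the 2-cumulant of the entries at `α` and `β` of a complex random matrix: the largest
2-cumulant of the real or imaginary part of the one with the real or imaginary part of the other. -/
def complexCov {Ω : Type*} [MeasurableSpace Ω] {N : ℕ} (P : Measure Ω)
    (W : Ω → Matrix (Fin N) (Fin N) ℂ) (α β : Fin N × Fin N) : ℝ :=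
  Finset.univ.sup' Finset.univ_nonempty fun p : Bool × Bool =>
    ‖cumulant P (complexEntries W) ![(α, p.1), (β, p.2)]‖

/-- `W` is a random real symmetric `N × N` matrix with centred entries, with moments bounded by
`μ`, and with polynomially decaying metric correlation structure with exponent `s`, constant
`Cκ` for the 2-cumulants and constants `C k` for the `k`-cumulants, `k ≥ 3`. -/
structure IsRealModel {Ω : Type*} [MeasurableSpace Ω] {N : ℕ}
    (μ : ℕ → ℝ) (s Cκ : ℝ) (C : ℕ → ℝ) (P : Measure Ω)
    (W : Ω → Matrix (Fin N) (Fin N) ℝ) : Prop where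
  measurable : ∀ i j, Measurable fun ω => W ω i j
  symmetric : ∀ ω, (W ω).IsSymm
  centred : ∀ i j, ∫ ω, W ω i j ∂P = 0
  moments : ∀ (q : ℕ) (i j : Fin N),
    Integrable (fun ω => |W ω i j| ^ q) P ∧ ∫ ω, |W ω i j| ^ q ∂P ≤ μ q
  decay_two : ∀ α β : Fin N × Fin N,
    ‖cumulant P (realEntries W) ![α, β]‖ ≤ Cκ / (1 + pairDist α β ^ s)
  decay_higher : ∀ (k : ℕ), 3 ≤ k → ∀ α : Fin k → Fin N × Fin N,
    ∃ T : SimpleGraph (Fin k),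
      IsMinSpanningTree (fun i j => pairDist (α i) (α j)) T ∧
      ‖cumulant P (realEntries W) α‖ ≤
        C k * ∏ e ∈ edges T, ‖cumulant P (realEntries W) ![α e.1, α e.2]‖

/-- `W` is a random complex Hermitian `N × N` matrix with centred entries, with moments bounded by
`μ`, and with polynomially decaying metric correlation structure, where the cumulants are those of
the real and imaginary parts of the entries. -/
structure IsHermitianModel {Ω : Type*} [MeasurableSpace Ω] {N : ℕ}
    (μ : ℕ → ℝ) (s Cκ : ℝ) (C : ℕ → ℝ) (P : Measure Ω)
    (W : Ω → Matrix (Fin N) (Fin N) ℂ) : Prop where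
  measurable : ∀ i j, Measurable fun ω => W ω i j
  hermitian : ∀ ω, (W ω).IsHermitian
  centred : ∀ i j, ∫ ω, W ω i j ∂P = 0
  moments : ∀ (q : ℕ) (i j : Fin N),
    Integrable (fun ω => ‖W ω i j‖ ^ q) P ∧ ∫ ω, ‖W ω i j‖ ^ q ∂P ≤ μ q
  decay_two : ∀ α β : Fin N × Fin N,
    complexCov P W α β ≤ Cκ / (1 + pairDist α β ^ s)
  decay_higher : ∀ (k : ℕ), 3 ≤ k → ∀ (α : Fin k → Fin N × Fin N) (σ : Fin k → Bool),
    ∃ T : SimpleGraph (Fin k),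
      IsMinSpanningTree (fun i j => pairDist (α i) (α j)) T ∧
      ‖cumulant P (complexEntries W) (fun j => (α j, σ j))‖ ≤
        C k * ∏ e ∈ edges T, complexCov P W (α e.1) (α e.2)

/-- The operator norm of a matrix with respect to the Euclidean norm. -/
def opNorm {𝕜 : Type*} [RCLike 𝕜] {N : ℕ} (A : Matrix (Fin N) (Fin N) 𝕜) : ℝ :=
  ‖Matrix.toEuclideanCLM (𝕜 := 𝕜) (n := Fin N) A‖

end CorrelatedMatrix

end

namespace CorrelatedMatrix

/-! The proof is the moment method with `p = 2 ^ n`. For Hermitian `W`, the `2p`-th power of the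
norm is at most the trace of `W ^ (2p)`, so Markov's inequality reduces the claim to bounding the
expected trace by a constant times `N ^ (p + 1)`. Then `t = N ^ ε * √N` gives probability `O(N ^ (1
- 2pε))`, and `p` is taken large.

The trace is a sum over walks of products of `2p` entries. Each mixed moment is a sum over
partitions of the steps of products of cumulants (`integral_prod_eq_sum_cumulant`). Centring kills
singleton blocks, so at most `p` blocks remain, and on each block the cumulant is bounded by decay
factors along a spanning tree (`abs_integral_prod_le`).

In the sum over walks (`sum_prod_pairWeight_le`), the start and the endpoint of the first step of
each block are free, at most `p + 1` vertices. Every other step is fixed by coordinate differences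
along tree edges. Each difference is summed over two copies of `ℤ²`, where the decay is summable
because `s > 2`. -/

lemma iteratedFDeriv_complex_exp (k : ℕ) (z : ℂ) (v : Fin k → ℂ) :
    iteratedFDeriv ℝ k Complex.exp z v = Complex.exp z * ∏ i, v i := by
  induction k generalizing z with
  | zero => simp
  | succ k ih =>
    have hd : DifferentiableAt ℝ (iteratedFDeriv ℝ k Complex.exp) z := by
      have : ContDiff ℝ ⊤ Complex.exp := Complex.contDiff_exp
      exact (this.differentiable_iteratedFDeriv (by exact WithTop.coe_lt_top _)) z
    rw [hd.iteratedFDeriv_succ_apply_left']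
    simp_rw [ih]
    have h : HasFDerivAt (𝕜 := ℝ) (fun y => Complex.exp y * ∏ i, Fin.tail v i) _ z :=
      (((Complex.hasDerivAt_exp z).hasFDerivAt.restrictScalars ℝ)).mul_const (∏ i, Fin.tail v i)
    rw [h.fderiv, Fin.prod_univ_succ]
    simp [Fin.tail]
    ring

lemma sum_partSize {n : ℕ} (c : OrderedFinpartition n) :
    ∑ b, c.partSize b = n := by
  have h := c.sum_sigma_eq_sum (fun _ => (1 : ℕ))
  simpa only [Finset.sum_const, Finset.card_univ, Fintype.card_fin, smul_eq_mul, mul_one] using h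

/-! ### Moments in terms of cumulants. -/

section Cumulants

variable {Ω ι : Type*} [MeasurableSpace Ω] [Fintype ι] [DecidableEq ι]
  {P : Measure Ω} [IsProbabilityMeasure P] {w : ι → Ω → ℝ}

omit [IsProbabilityMeasure P] in
lemma memLp_of_integrable_pow {f : Ω → ℝ} (hf : Measurable f)
    (hq : ∀ q : ℕ, Integrable (fun ω => |f ω| ^ q) P) (q : ℕ) : MemLp f q P := by
  rcases Nat.eq_zero_or_pos q with rfl | hpos
  · simpa using hf.aestronglyMeasurable
  · rw [← integrable_norm_rpow_iff hf.aestronglyMeasurable (by exact_mod_cast hpos.ne') (by simp)]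
    simpa using hq q

/-- Hölder's inequality with exponent `s.card` on every factor puts the product in `L¹`, or in `L^∞`
when `s` is empty. -/
lemma integrable_prod_of_memLp {κ : Type*} (s : Finset κ) {f : κ → Ω → ℝ}
    (hf : ∀ i, ∀ q : ℕ, MemLp (f i) q P) : Integrable (fun ω => ∏ i ∈ s, f i ω) P := by
  have h : MemLp (fun ω => ∏ i ∈ s, f i ω) (∑ i ∈ s, ((s.card : ℕ) : ENNReal)⁻¹)⁻¹ P := by
    have := MemLp.prod' (s := s) (f := f) (p := fun _ => ((s.card : ℕ) : ENNReal)) (μ := P)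
      (fun i _ => hf i _)
    simpa using this
  refine h.integrable ?_
  rcases s.eq_empty_or_nonempty with rfl | hs
  · simp
  · have h0 : (s.card : ENNReal) ≠ 0 := by simpa using hs.ne_empty
    simp [ENNReal.mul_inv_cancel h0 (by simp)]

omit [DecidableEq ι] [IsProbabilityMeasure P] in
lemma memLp_id_map (hw : ∀ i, Measurable (w i)) (hL : ∀ i, ∀ q : ℕ, MemLp (w i) q P) (q : ℕ) :
    MemLp id q (P.map fun ω => WithLp.toLp 2 fun i => w i ω) := by
  have hm : Measurable fun ω => WithLp.toLp 2 fun i => w i ω := by fun_prop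
  rw [memLp_map_measure_iff (by fun_prop) hm.aemeasurable]
  refine (memLp_piLp_iff).2 fun i => ?_
  exact hL i q

/-- The moment-cumulant formula. -/
theorem integral_prod_eq_sum_cumulant (hw : ∀ i, Measurable (w i))
    (hL : ∀ i, ∀ q : ℕ, MemLp (w i) q P) {k : ℕ} (α : Fin k → ι) :
    ((∫ ω, ∏ j, w (α j) ω ∂P : ℝ) : ℂ) =
      ∑ c : OrderedFinpartition k, ∏ b, cumulant P w (α ∘ c.emb b) := by
  have hm : Measurable fun ω => WithLp.toLp 2 fun i => w i ω := by fun_prop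
  set ν : Measure (EuclideanSpace ℝ ι) := P.map fun ω => WithLp.toLp 2 fun i => w i ω with hν
  have : IsProbabilityMeasure ν := Measure.isProbabilityMeasure_map hm.aemeasurable
  have hid : ∀ q : ℕ, MemLp id q ν := memLp_id_map hw hL
  have hf : ContDiff ℝ k (charFun ν) := contDiff_charFun (hid k)
  have hf0 : charFun ν 0 = 1 := by simp
  set g : EuclideanSpace ℝ ι → ℂ := fun t => Complex.log (charFun ν t) with hg
  have hgc : ContDiffAt ℝ k g 0 := by
    have : ContDiffAt ℝ k Complex.log (charFun ν 0) := by
      refine (Complex.contDiffAt_log ?_).restrict_scalars ℝ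
      rw [hf0]; exact Complex.one_mem_slitPlane
    exact this.comp 0 hf.contDiffAt
  -- The characteristic function is nonzero near `0`, so it is the exponential of its logarithm
  -- there; this identity is differentiated `k` times.
  have heq : Complex.exp ∘ g =ᶠ[nhds 0] charFun ν := by
    have : ∀ᶠ t in nhds 0, charFun ν t ≠ 0 :=
      hf.continuous.continuousAt.eventually_ne (by rw [hf0]; exact one_ne_zero)
    filter_upwards [this] with t ht
    exact Complex.exp_log ht
  have hexp : ContDiffAt ℝ k Complex.exp (g 0) := Complex.contDiff_exp.contDiffAt
  -- Faà di Bruno's formula: one term per partition. The outer derivative is multiplication with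
  -- factor `exp (g 0) = 1`, so only the product over blocks of derivatives of `g` survives.
  have h1 := iteratedFDeriv_comp hexp hgc le_rfl
  rw [(heq.iteratedFDeriv ℝ k).eq_of_nhds] at h1
  have h2 := congrArg (fun F => F fun j => EuclideanSpace.single (α j) (1 : ℝ)) h1
  have hg0 : g 0 = 0 := by simp [hg]
  simp only [FormalMultilinearSeries.taylorComp,
    sum_apply,
    FormalMultilinearSeries.compAlongOrderedFinpartition_apply, ftaylorSeries,
    iteratedFDeriv_complex_exp, OrderedFinpartition.applyOrderedFinpartition_apply] at h2
  have h3 : ∀ c : OrderedFinpartition k, ∏ b, iteratedFDeriv ℝ (c.partSize b) g 0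
      ((fun j => EuclideanSpace.single (α j) (1 : ℝ)) ∘ c.emb b) =
      Complex.I ^ k * ∏ b, cumulant P w (α ∘ c.emb b) := by
    intro c
    have hI : Complex.I ^ k = Complex.I ^ ∑ b, c.partSize b := by rw [sum_partSize c]
    rw [hI, ← Finset.prod_pow_eq_pow_sum,
      ← Finset.prod_mul_distrib]
    refine Finset.prod_congr rfl fun b _ => ?_
    rw [cumulant, ← mul_assoc, ← mul_pow]
    simp [hg, hν, Function.comp_def]
  simp only [h3, hg0] at h2
  simp only [Complex.exp_zero, one_mul] at h2
  rw [← Finset.mul_sum, iteratedFDeriv_charFun (hid k)] at h2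
  have h4 := mul_left_cancel₀ (pow_ne_zero _ Complex.I_ne_zero) h2
  rw [← h4, ← integral_complex_ofReal, hν, integral_map hm.aemeasurable (by fun_prop)]
  simp [EuclideanSpace.inner_single_right]

lemma cumulant_one (hw : ∀ i, Measurable (w i)) (hL : ∀ i, ∀ q : ℕ, MemLp (w i) q P)
    (α : Fin 1 → ι) : cumulant P w α = ((∫ ω, w (α 0) ω ∂P : ℝ) : ℂ) := by
  have h := integral_prod_eq_sum_cumulant hw hL α
  rw [Fintype.sum_unique] at h
  -- The only partition of one point has a single block of size one, and this holds definitionally.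
  have h' : ((∫ ω, ∏ j, w (α j) ω ∂P : ℝ) : ℂ) =
      ∏ b : Fin 1, cumulant P w (α ∘ fun _ : Fin 1 => b) := h
  rw [Fin.prod_univ_one] at h'
  simp only [Fin.prod_univ_one] at h'
  rw [h']
  congr 1
  ext i
  rw [Subsingleton.elim i 0]
  rfl

end Cumulants

/-! ### Counting walks through coordinate differences. -/

section Combinatorics

/-- The weight of a pair of coordinate differences. The label records which of the two ways of
matching the coordinates of two index pairs is used. -/
noncomputable def diffWeight (s : ℝ) (x : Bool × (Fin 2 → ℤ)) : ℝ :=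
  (1 + (|(x.2 0 : ℝ)| + |(x.2 1 : ℝ)|) ^ s)⁻¹

lemma diffWeight_nonneg (s : ℝ) (x : Bool × (Fin 2 → ℤ)) : 0 ≤ diffWeight s x := by
  unfold diffWeight; positivity

/-- Comparison with the lattice sum of `‖x‖ ^ (-s)` over `ℤ²`, which converges because `s > 2`; the
sup norm is at most the sum of the two absolute values. -/
lemma summable_diffWeight {s : ℝ} (hs : 2 < s) : Summable (diffWeight s) := by
  have h : Summable fun x : Fin 2 → ℤ => (1 + (|(x 0 : ℝ)| + |(x 1 : ℝ)|) ^ s)⁻¹ := by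
    -- Since `0 ^ (-s) = 0` while the weight at the origin is `1`, the origin needs its own term.
    have h1 : Summable fun x : Fin 2 → ℤ => ‖x‖ ^ (-s) + if x = 0 then (1 : ℝ) else 0 :=
      (EisensteinSeries.summable_one_div_norm_rpow hs).add
        (summable_of_ne_finset_zero (s := {0}) fun b hb => by
          simp only [Finset.mem_singleton] at hb; simp [hb])
    refine Summable.of_nonneg_of_le (fun x => by positivity) (fun x => ?_) h1
    rcases eq_or_ne x 0 with rfl | hx
    · simp [Real.zero_rpow (show s ≠ 0 by linarith), Real.zero_rpow (show -s ≠ 0 by linarith)]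
    · have hx0 : 0 < ‖x‖ := norm_pos_iff.2 hx
      have hle : ‖x‖ ≤ |(x 0 : ℝ)| + |(x 1 : ℝ)| := by
        rw [pi_norm_le_iff_of_nonneg (by positivity)]
        intro i
        fin_cases i <;> simp [Int.norm_eq_abs]
      rw [if_neg hx, add_zero, Real.rpow_neg hx0.le]
      gcongr
      have := Real.rpow_le_rpow hx0.le hle (show 0 ≤ s by linarith)
      linarith
  have h2 : Summable fun x : Bool × (Fin 2 → ℤ) =>
      (1 + (|(x.2 0 : ℝ)| + |(x.2 1 : ℝ)|) ^ s)⁻¹ := by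
    rw [← (Equiv.boolProdEquivSum (Fin 2 → ℤ)).symm.summable_iff]
    exact Summable.sum (f := _ ∘ _) h h
  exact h2

variable {N : ℕ}

/-- The inverse polynomial decay factor of two index pairs. -/
noncomputable def pairWeight (s : ℝ) (α β : Fin N × Fin N) : ℝ := (1 + pairDist α β ^ s)⁻¹

lemma pairDist_nonneg (α β : Fin N × Fin N) : 0 ≤ pairDist α β := by
  unfold pairDist; positivity

lemma pairWeight_nonneg (s : ℝ) (α β : Fin N × Fin N) : 0 ≤ pairWeight s α β := by
  have := Real.rpow_nonneg (pairDist_nonneg α β) s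
  unfold pairWeight; positivity

/-- The coordinate differences of two index pairs, for the matching of coordinates
that realizes their distance. -/
noncomputable def pairDiff (α β : Fin N × Fin N) : Bool × (Fin 2 → ℤ) :=
  if |((α.1 : ℕ) : ℝ) - ((β.1 : ℕ) : ℝ)| + |((α.2 : ℕ) : ℝ) - ((β.2 : ℕ) : ℝ)| ≤
    |((α.1 : ℕ) : ℝ) - ((β.2 : ℕ) : ℝ)| + |((α.2 : ℕ) : ℝ) - ((β.1 : ℕ) : ℝ)| then
  (false, ![(α.1 : ℤ) - (β.1 : ℤ), (α.2 : ℤ) - (β.2 : ℤ)])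
  else (true, ![(α.1 : ℤ) - (β.2 : ℤ), (α.2 : ℤ) - (β.1 : ℤ)])

lemma diffWeight_pairDiff (s : ℝ) (α β : Fin N × Fin N) :
    diffWeight s (pairDiff α β) = pairWeight s α β := by
  unfold pairDiff diffWeight pairWeight pairDist
  split_ifs with h
  · rw [min_eq_left h]; simp
  · rw [min_eq_right (not_le.1 h).le]; simp

/-- Once the matching and the differences are known, either index pair determines the other. -/
lemma eq_iff_eq_of_pairDiff_eq {α β α' β' : Fin N × Fin N} (h : pairDiff α β = pairDiff α' β') :
    α = α' ↔ β = β' := by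
  unfold pairDiff at h
  split_ifs at h <;> simp at h <;> simp only [Prod.ext_iff, Fin.ext_iff] <;> omega

/-- The `j`-th step of a walk. -/
def step {m : ℕ} (a : Fin (m + 1) → Fin N) (j : Fin m) : Fin N × Fin N := (a j.castSucc, a j.succ)

/-- Every `j` outside of `R` is connected through `E` to a smaller index. -/
def IsRooted {m : ℕ} (R : Finset (Fin m)) (E : Finset (Fin m × Fin m)) : Prop :=
  ∀ j ∉ R, ∃ i < j, Relation.EqvGen (fun x y => (x, y) ∈ E) i j

/-- The walk is rebuilt from left to right. Vertex `j + 1` is given if `j ∈ R`. Otherwise step `j`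
is linked to some step `i < j` whose two ends are already known, and the differences along the link
carry this knowledge to step `j`. -/
lemma walk_eq_of_rooted {m : ℕ} {R : Finset (Fin m)} {E : Finset (Fin m × Fin m)}
    (hR : IsRooted R E) {a a' : Fin (m + 1) → Fin N} (h0 : a 0 = a' 0)
    (hr : ∀ j ∈ R, a j.succ = a' j.succ)
    (he : ∀ e ∈ E, pairDiff (step a e.1) (step a e.2) = pairDiff (step a' e.1) (step a' e.2)) :
    a = a' := by
  have key : ∀ i j, Relation.EqvGen (fun x y => (x, y) ∈ E) i j →
      (step a i = step a' i ↔ step a j = step a' j) := by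
    intro i j hij
    induction hij with
    | rel x y hxy => exact eq_iff_eq_of_pairDiff_eq (he (x, y) hxy)
    | refl x => exact Iff.rfl
    | symm x y _ ih => exact ih.symm
    | trans x y z _ _ ih1 ih2 => exact ih1.trans ih2
  have main : ∀ n (hn : n < m + 1), a ⟨n, hn⟩ = a' ⟨n, hn⟩ := by
    intro n
    induction n using Nat.strong_induction_on with
    | _ n ih =>
      intro hn
      rcases n with _ | n
      · exact h0
      · have hnm : n < m := by omega
        by_cases hj : (⟨n, hnm⟩ : Fin m) ∈ R
        · exact hr _ hj
        · obtain ⟨i, hi, hij⟩ := hR _ hj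
          have hi' : (i : ℕ) < n := hi
          have hstep : step a i = step a' i := by
            unfold step
            rw [Prod.mk.injEq]
            exact ⟨ih i (by omega) _, ih (i + 1) (by omega) _⟩
          exact congrArg Prod.snd ((key _ _ hij).1 hstep)
  ext i
  rw [main i.1 i.2]

/-- The summand depends only on the differences along `E`, and the map `Φ` to free vertices and
differences is injective. Enlarging its image to a full product makes the sum factor: `N` for each
free vertex, the total lattice weight for each edge. -/
theorem sum_prod_pairWeight_le {m : ℕ} {s : ℝ} (hs : 2 < s) {R : Finset (Fin m)}
    {E : Finset (Fin m × Fin m)} (hR : IsRooted R E) :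
    ∑ a : Fin (m + 1) → Fin N, ∏ e ∈ E, pairWeight s (step a e.1) (step a e.2) ≤
      (N : ℝ) ^ (R.card + 1) * (∑' x, diffWeight s x) ^ E.card := by
  classical
  let Φ : (Fin (m + 1) → Fin N) → (Fin N × (R → Fin N)) × (E → Bool × (Fin 2 → ℤ)) := fun a =>
    ((a 0, fun j => a (j : Fin m).succ), fun e => pairDiff (step a e.1.1) (step a e.1.2))
  have hΦ : Function.Injective Φ := by
    intro a a' h
    simp only [Φ, Prod.mk.injEq] at h
    exact walk_eq_of_rooted hR h.1.1 (fun j hj => congrFun h.1.2 ⟨j, hj⟩)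
      fun e he => congrFun h.2 ⟨e, he⟩
  -- Only finitely many differences occur, so the enlarged sum is finite; the series replaces it at
  -- the end.
  let S : Finset (Bool × (Fin 2 → ℤ)) :=
    Finset.univ.image fun p : (Fin N × Fin N) × (Fin N × Fin N) => pairDiff p.1 p.2
  let U : Finset ((Fin N × (R → Fin N)) × (E → Bool × (Fin 2 → ℤ))) :=
    Finset.univ ×ˢ Fintype.piFinset fun _ => S
  calc ∑ a : Fin (m + 1) → Fin N, ∏ e ∈ E, pairWeight s (step a e.1) (step a e.2)
      = ∑ a : Fin (m + 1) → Fin N, ∏ e : E, diffWeight s ((Φ a).2 e) := by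
        refine Finset.sum_congr rfl fun a _ => ?_
        rw [← Finset.prod_coe_sort]
        exact Finset.prod_congr rfl fun e _ => (diffWeight_pairDiff s _ _).symm
    _ = ∑ y ∈ Finset.univ.image Φ, ∏ e : E, diffWeight s (y.2 e) :=
        (Finset.sum_image (f := fun y : (Fin N × (R → Fin N)) × (E → Bool × (Fin 2 → ℤ)) =>
          ∏ e : E, diffWeight s (y.2 e)) fun _ _ _ _ h => hΦ h).symm
    _ ≤ ∑ y ∈ U, ∏ e : E, diffWeight s (y.2 e) := by
        refine Finset.sum_le_sum_of_subset_of_nonneg ?_ fun y _ _ =>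
          Finset.prod_nonneg fun e _ => diffWeight_nonneg s _
        intro y hy
        obtain ⟨a, -, rfl⟩ := Finset.mem_image.1 hy
        simp only [U, Finset.mem_product, Finset.mem_univ, true_and, Fintype.mem_piFinset]
        exact fun e => Finset.mem_image.2
          ⟨(step a e.1.1, step a e.1.2), Finset.mem_univ _, rfl⟩
    _ = (N : ℝ) ^ (R.card + 1) * (∑ x ∈ S, diffWeight s x) ^ E.card := by
        simp only [U, Finset.sum_product]
        rw [← Finset.prod_univ_sum]
        rw [Finset.sum_const, Finset.prod_const, nsmul_eq_mul]
        simp only [Finset.card_univ, Fintype.card_prod, Fintype.card_fun, Fintype.card_fin,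
          Fintype.card_coe]
        push_cast
        ring
    _ ≤ _ := by
        gcongr
        · exact Finset.sum_nonneg fun x _ => diffWeight_nonneg s x
        · exact (summable_diffWeight hs).sum_le_tsum _ fun x _ => diffWeight_nonneg s x

end Combinatorics

/-! ### From spanning trees on blocks to rooted sets of edges. -/

/-- The roots are the least elements of the blocks: any other element is joined to its root, which
is smaller, by a path in the tree of its block. -/
lemma isRooted_of_connected {m : ℕ} (c : OrderedFinpartition m)
    (T : ∀ b, SimpleGraph (Fin (c.partSize b))) (hT : ∀ b, (T b).Connected) :
    IsRooted (Finset.univ.image fun b => c.emb b ⟨0, c.partSize_pos b⟩)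
      (Finset.univ.biUnion fun b => (edges (T b)).image (Prod.map (c.emb b) (c.emb b))) := by
  intro j hj
  obtain ⟨⟨b, r⟩, rfl⟩ := c.exists_inverse j
  have hr : r ≠ ⟨0, c.partSize_pos b⟩ := by
    rintro rfl
    exact hj (Finset.mem_image_of_mem _ (Finset.mem_univ b))
  refine ⟨c.emb b ⟨0, c.partSize_pos b⟩, c.emb_strictMono b ?_, ?_⟩
  · rw [Fin.lt_def]
    exact Nat.pos_of_ne_zero fun h => hr (Fin.ext h)
  · have h := (SimpleGraph.reachable_iff_reflTransGen _ _).1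
      ((hT b).preconnected ⟨0, c.partSize_pos b⟩ r)
    have hmem : ∀ x y, (T b).Adj x y → x < y → (c.emb b x, c.emb b y) ∈
        Finset.univ.biUnion fun b => (edges (T b)).image (Prod.map (c.emb b) (c.emb b)) := by
      intro x y hxy hlt
      refine Finset.mem_biUnion.2 ⟨b, Finset.mem_univ b, Finset.mem_image.2 ⟨(x, y), ?_, rfl⟩⟩
      simp [edges, hxy, hlt]
    induction h with
    | refl => exact .refl _
    | @tail x y _ hxy ih =>
      -- The induction hypothesis assumes that `x` is not the root, so an edge leaving the root is
      -- treated directly.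
      by_cases hx : x = ⟨0, c.partSize_pos b⟩
      · subst hx
        rcases lt_or_gt_of_ne hxy.ne with hlt | hlt
        · exact .rel _ _ (hmem _ _ hxy hlt)
        · exact .symm _ _ (.rel _ _ (hmem _ _ hxy.symm hlt))
      · refine .trans _ _ _ (ih ?_ hx) ?_
        · intro hx'
          obtain ⟨b', -, h'⟩ := Finset.mem_image.1 hx'
          by_cases hb : b' = b
          · subst hb
            exact hx ((c.emb_strictMono b').injective h').symm
          · exact c.emb_ne_emb_of_ne hb h'
        · rcases lt_or_gt_of_ne hxy.ne with hlt | hlt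
          · exact .rel _ _ (hmem _ _ hxy hlt)
          · exact .symm _ _ (.rel _ _ (hmem _ _ hxy.symm hlt))

lemma prod_biUnion_edges {m : ℕ} (c : OrderedFinpartition m)
    (T : ∀ b, SimpleGraph (Fin (c.partSize b))) (f : Fin m × Fin m → ℝ) :
    ∏ e ∈ Finset.univ.biUnion fun b => (edges (T b)).image (Prod.map (c.emb b) (c.emb b)), f e =
      ∏ b, ∏ e ∈ edges (T b), f (c.emb b e.1, c.emb b e.2) := by
  rw [Finset.prod_biUnion]
  · refine Finset.prod_congr rfl fun b _ => ?_
    rw [Finset.prod_image]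
    · rfl
    · exact fun _ _ _ _ h =>
        (Function.Injective.prodMap (c.emb_strictMono b).injective (c.emb_strictMono b).injective) h
  · intro b _ b' _ hbb
    rw [Function.onFun, Finset.disjoint_left]
    intro e he he'
    obtain ⟨x, -, rfl⟩ := Finset.mem_image.1 he
    obtain ⟨y, -, hy⟩ := Finset.mem_image.1 he'
    exact c.emb_ne_emb_of_ne hbb.symm (congrArg Prod.fst hy)

lemma two_mul_length_le {m : ℕ} (c : OrderedFinpartition m) (h : ∀ b, 2 ≤ c.partSize b) :
    2 * c.length ≤ m := by
  calc 2 * c.length = ∑ _b : Fin c.length, 2 := by simp [mul_comm]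
    _ ≤ ∑ b, c.partSize b := Finset.sum_le_sum fun b _ => h b
    _ = m := sum_partSize c

open Classical in
/-- The sets of pairs of steps that leave at most `m / 2` steps unconnected to earlier ones. -/
noncomputable def halfRooted (m : ℕ) : Finset (Finset (Fin m × Fin m)) :=
  Finset.univ.filter fun E => ∃ R : Finset (Fin m), 2 * R.card ≤ m ∧ IsRooted R E

/-- A bound for the `m`-th mixed moments in terms of the constants in the bounds of cumulants. -/
noncomputable def momentConst (B : ℕ → ℝ) (m : ℕ) : ℝ :=
  ∑ c : OrderedFinpartition m, ∏ b, B (c.partSize b)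

/-! ### Mixed moments and their sum over walks. -/

section Moments

variable {Ω ι : Type*} [MeasurableSpace Ω] [Fintype ι] [DecidableEq ι]
  {P : Measure Ω} [IsProbabilityMeasure P] {w : ι → Ω → ℝ} {N : ℕ}

/-- The trees depend on `α`. Summing over all of `halfRooted m` gives a bound whose edge sets no
longer do, so that the sum over walks can later be taken first. -/
theorem abs_integral_prod_le (hw : ∀ i, Measurable (w i)) (hL : ∀ i, ∀ q : ℕ, MemLp (w i) q P)
    (h0 : ∀ i, ∫ ω, w i ω ∂P = 0) (ρ : ι → Fin N × Fin N) {B : ℕ → ℝ} (hB : ∀ k, 0 ≤ B k) {s : ℝ}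
    (hκ : ∀ k, 2 ≤ k → ∀ α : Fin k → ι, ∃ T : SimpleGraph (Fin k), T.Connected ∧
      ‖cumulant P w α‖ ≤ B k * ∏ e ∈ edges T, pairWeight s (ρ (α e.1)) (ρ (α e.2)))
    {m : ℕ} (α : Fin m → ι) :
    |∫ ω, ∏ j, w (α j) ω ∂P| ≤ momentConst B m *
      ∑ E ∈ halfRooted m, ∏ e ∈ E, pairWeight s (ρ (α e.1)) (ρ (α e.2)) := by
  classical
  rw [← Real.norm_eq_abs, ← Complex.norm_real, integral_prod_eq_sum_cumulant hw hL α, momentConst, Finset.sum_mul]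
  refine (norm_sum_le _ _).trans (Finset.sum_le_sum fun c _ => ?_)
  have hS : ∀ E ∈ halfRooted m, 0 ≤ ∏ e ∈ E, pairWeight s (ρ (α e.1)) (ρ (α e.2)) :=
    fun E _ => Finset.prod_nonneg fun e _ => pairWeight_nonneg s _ _
  rw [norm_prod]
  by_cases hc : ∀ b, 2 ≤ c.partSize b
  · choose T hT hle using fun b => hκ (c.partSize b) (hc b) (α ∘ c.emb b)
    set E := Finset.univ.biUnion fun b => (edges (T b)).image (Prod.map (c.emb b) (c.emb b))
      with hE
    have hmem : E ∈ halfRooted m := by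
      refine Finset.mem_filter.2 ⟨Finset.mem_univ _, _, ?_, isRooted_of_connected c T hT⟩
      have := Finset.card_image_le (s := Finset.univ)
        (f := fun b => c.emb b ⟨0, c.partSize_pos b⟩)
      rw [Finset.card_univ, Fintype.card_fin] at this
      linarith [two_mul_length_le c hc]
    calc ∏ b, ‖cumulant P w (α ∘ c.emb b)‖
        ≤ ∏ b, (B (c.partSize b) * ∏ e ∈ edges (T b),
          pairWeight s (ρ ((α ∘ c.emb b) e.1)) (ρ ((α ∘ c.emb b) e.2))) :=
          Finset.prod_le_prod (fun _ _ => norm_nonneg _) fun b _ => hle b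
      _ = (∏ b, B (c.partSize b)) * ∏ e ∈ E, pairWeight s (ρ (α e.1)) (ρ (α e.2)) := by
          rw [Finset.prod_mul_distrib, hE, prod_biUnion_edges]
          rfl
      _ ≤ _ := by
          gcongr
          · exact Finset.prod_nonneg fun b _ => hB _
          · exact Finset.single_le_sum hS hmem
  -- A block with fewer than two elements is a singleton, and its cumulant is a mean, hence zero.
  · push Not at hc
    obtain ⟨b, hb⟩ := hc
    have hzero : ∀ k, k = 1 → ∀ β : Fin k → ι, cumulant P w β = 0 := by
      rintro k rfl β
      rw [cumulant_one hw hL, h0, Complex.ofReal_zero]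
    rw [Finset.prod_eq_zero (Finset.mem_univ b)]
    · exact mul_nonneg (Finset.prod_nonneg fun b _ => hB _) (Finset.sum_nonneg hS)
    · rw [hzero _ (by have := c.partSize_pos b; omega), norm_zero]

/-- The constant in the bound for the sum over all walks of length `m`. -/
noncomputable def walkConst (B : ℕ → ℝ) (s : ℝ) (m : ℕ) : ℝ :=
  momentConst B m * ∑ E ∈ halfRooted m, (∑' x, diffWeight s x) ^ E.card

lemma momentConst_nonneg {B : ℕ → ℝ} (hB : ∀ k, 0 ≤ B k) (m : ℕ) : 0 ≤ momentConst B m :=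
  Finset.sum_nonneg fun _ _ => Finset.prod_nonneg fun _ _ => hB _

lemma tsum_diffWeight_nonneg (s : ℝ) : 0 ≤ ∑' x, diffWeight s x :=
  tsum_nonneg fun x => diffWeight_nonneg s x

lemma walkConst_nonneg {B : ℕ → ℝ} (hB : ∀ k, 0 ≤ B k) (s : ℝ) (m : ℕ) : 0 ≤ walkConst B s m :=
  mul_nonneg (momentConst_nonneg hB m)
    (Finset.sum_nonneg fun _ _ => pow_nonneg (tsum_diffWeight_nonneg s) _)

/-- At most `p` of the `2p` steps are roots, and the starting vertex adds one more power of `N`. The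
map `ρ` allows several real variables per matrix position, as needed for real and imaginary parts.
-/
theorem sum_abs_integral_walk_le (hN : 1 ≤ N) (hw : ∀ i, Measurable (w i))
    (hL : ∀ i, ∀ q : ℕ, MemLp (w i) q P)
    (h0 : ∀ i, ∫ ω, w i ω ∂P = 0) (ρ : ι → Fin N × Fin N) {B : ℕ → ℝ} (hB : ∀ k, 0 ≤ B k) {s : ℝ}
    (hs : 2 < s)
    (hκ : ∀ k, 2 ≤ k → ∀ α : Fin k → ι, ∃ T : SimpleGraph (Fin k), T.Connected ∧
      ‖cumulant P w α‖ ≤ B k * ∏ e ∈ edges T, pairWeight s (ρ (α e.1)) (ρ (α e.2)))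
    {p : ℕ} (α : (Fin (2 * p + 1) → Fin N) → Fin (2 * p) → ι)
    (hα : ∀ a j, ρ (α a j) = step a j) :
    ∑ a, |∫ ω, ∏ j, w (α a j) ω ∂P| ≤ walkConst B s (2 * p) * (N : ℝ) ^ (p + 1) := by
  classical
  have hN' : (1 : ℝ) ≤ N := by exact_mod_cast hN
  calc ∑ a, |∫ ω, ∏ j, w (α a j) ω ∂P|
      ≤ ∑ a, momentConst B (2 * p) * ∑ E ∈ halfRooted (2 * p),
        ∏ e ∈ E, pairWeight s (step a e.1) (step a e.2) := by
        refine Finset.sum_le_sum fun a _ => ?_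
        simpa only [hα] using abs_integral_prod_le hw hL h0 ρ hB hκ (α a)
    _ = momentConst B (2 * p) * ∑ E ∈ halfRooted (2 * p), ∑ a : Fin (2 * p + 1) → Fin N,
        ∏ e ∈ E, pairWeight s (step a e.1) (step a e.2) := by
        rw [← Finset.mul_sum, Finset.sum_comm]
    _ ≤ momentConst B (2 * p) * ∑ E ∈ halfRooted (2 * p),
        (∑' x, diffWeight s x) ^ E.card * (N : ℝ) ^ (p + 1) := by
        refine mul_le_mul_of_nonneg_left (Finset.sum_le_sum fun E hE => ?_)
          (momentConst_nonneg hB _)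
        obtain ⟨-, R, hR, hRE⟩ := Finset.mem_filter.1 hE
        refine (sum_prod_pairWeight_le hs hRE).trans ?_
        rw [mul_comm]
        refine mul_le_mul_of_nonneg_left (pow_le_pow_right₀ hN' (by omega))
          (pow_nonneg (tsum_diffWeight_nonneg s) _)
    _ = _ := by rw [walkConst, ← Finset.sum_mul, mul_assoc]

end Moments

/-! ### Operator norm, trace and walks. -/

section Deterministic

variable {𝕜 : Type*} [RCLike 𝕜] {N : ℕ}

lemma opNorm_sq_le (A : Matrix (Fin N) (Fin N) 𝕜) : opNorm A ^ 2 ≤ ∑ i, ∑ j, ‖A i j‖ ^ 2 := by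
  have hS : 0 ≤ ∑ i, ∑ j, ‖A i j‖ ^ 2 := by positivity
  refine (Real.le_sqrt (norm_nonneg _) hS).1 ?_
  refine ContinuousLinearMap.opNorm_le_bound _ (Real.sqrt_nonneg _) fun x => ?_
  rw [EuclideanSpace.norm_eq, EuclideanSpace.norm_eq, ← Real.sqrt_mul hS]
  refine Real.sqrt_le_sqrt ?_
  rw [Finset.sum_mul]
  refine Finset.sum_le_sum fun i _ => ?_
  rw [Matrix.ofLp_toEuclideanCLM]
  calc ‖∑ j, A i j * x j‖ ^ 2 ≤ (∑ j, ‖A i j‖ * ‖x j‖) ^ 2 := by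
        gcongr
        exact (norm_sum_le _ _).trans_eq (by simp only [norm_mul])
    _ ≤ _ := Finset.sum_mul_sq_le_sq_mul_sq _ _ _

lemma opNorm_smul (r : ℝ) (A : Matrix (Fin N) (Fin N) 𝕜) : opNorm (r • A) = |r| * opNorm A := by
  have : r • A = (r : 𝕜) • A := by
    ext i j; simp [RCLike.real_smul_eq_coe_mul]
  rw [this, opNorm, opNorm, map_smul, norm_smul, RCLike.norm_ofReal]

/-- The C*-identity, iterated `n` times, gives `‖A‖ ^ (2 ^ n) = ‖A ^ (2 ^ n)‖`; this is why the
exponent is a power of two. The squared Frobenius norm of `A ^ (2 ^ n)` is the trace of its square.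
-/
lemma opNorm_pow_le_re_trace {A : Matrix (Fin N) (Fin N) 𝕜} (hA : A.IsHermitian) (n : ℕ) :
    opNorm A ^ (2 * 2 ^ n) ≤ RCLike.re (A ^ (2 * 2 ^ n)).trace := by
  have hsa : IsSelfAdjoint (Matrix.toEuclideanCLM (𝕜 := 𝕜) (n := Fin N) A) := by
    have : IsSelfAdjoint A := hA
    exact this.map _
  have h1 : opNorm A ^ 2 ^ n = opNorm (A ^ 2 ^ n) := by
    rw [opNorm, opNorm, map_pow, hsa.norm_pow_two_pow]
  have hp : (A ^ 2 ^ n).IsHermitian := hA.pow _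
  rw [mul_comm, pow_mul, h1, pow_mul]
  refine (opNorm_sq_le _).trans_eq ?_
  rw [Matrix.trace, map_sum]
  refine Finset.sum_congr rfl fun i _ => ?_
  rw [sq (A ^ 2 ^ n), Matrix.diag_apply, Matrix.mul_apply, map_sum]
  refine Finset.sum_congr rfl fun j _ => ?_
  rw [← hp.apply j i, RCLike.star_def, RCLike.mul_conj]
  norm_cast

lemma matrix_pow_apply_eq_sum_walk (A : Matrix (Fin N) (Fin N) 𝕜) (m : ℕ) (i j : Fin N) :
    (A ^ m) i j = ∑ a : Fin (m + 1) → Fin N,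
      if a 0 = i ∧ a (Fin.last m) = j then ∏ l, A (step a l).1 (step a l).2 else 0 := by
  induction m generalizing i with
  | zero =>
    rw [← (Equiv.funUnique (Fin 1) (Fin N)).symm.sum_comp]
    simp [Matrix.one_apply, ite_and]
  | succ m ih =>
    rw [pow_succ', Matrix.mul_apply, ← (Fin.consEquiv fun _ => Fin N).sum_comp,
      Fintype.sum_prod_type]
    symm
    simp only [Fin.consEquiv_apply, Fin.cons_zero]
    rw [Finset.sum_eq_single i (fun b _ hb => by simp [hb]) (by simp)]
    simp only [ih, Finset.mul_sum]
    rw [Finset.sum_comm]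
    refine Finset.sum_congr rfl fun a _ => ?_
    rw [Finset.sum_eq_single (a 0) (fun b _ hb => by simp [hb.symm]) (by simp)]
    rw [← Fin.succ_last, Fin.cons_succ, Fin.prod_univ_succ]
    simp [step]

lemma trace_pow_eq_sum_walk (A : Matrix (Fin N) (Fin N) 𝕜) (m : ℕ) :
    (A ^ m).trace = ∑ a : Fin (m + 1) → Fin N,
      if a (Fin.last m) = a 0 then ∏ l, A (step a l).1 (step a l).2 else 0 := by
  simp only [Matrix.trace, Matrix.diag_apply, matrix_pow_apply_eq_sum_walk]
  rw [Finset.sum_comm]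
  refine Finset.sum_congr rfl fun a _ => ?_
  simp [ite_and]

end Deterministic

/-- Markov's inequality for the trace, which is nonnegative because it dominates a power of the
norm. -/
theorem measureReal_lt_opNorm_le {𝕜 Ω : Type*} [RCLike 𝕜] [MeasurableSpace Ω] {N : ℕ}
    {P : Measure Ω} [IsProbabilityMeasure P] {W : Ω → Matrix (Fin N) (Fin N) 𝕜}
    (hW : ∀ ω, (W ω).IsHermitian) (n : ℕ)
    (hint : ∀ a : Fin (2 * 2 ^ n + 1) → Fin N,
      Integrable (fun ω => ∏ l, W ω (step a l).1 (step a l).2) P)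
    {M : ℝ} (hM : ∑ a : Fin (2 * 2 ^ n + 1) → Fin N,
      ‖∫ ω, ∏ l, W ω (step a l).1 (step a l).2 ∂P‖ ≤ M) {t : ℝ} (ht : 0 < t) :
    P.real {ω | t < opNorm (W ω)} ≤ M / t ^ (2 * 2 ^ n) := by
  set m := 2 * 2 ^ n with hm
  have hint' : ∀ a : Fin (m + 1) → Fin N, Integrable (fun ω =>
      if a (Fin.last m) = a 0 then ∏ l, W ω (step a l).1 (step a l).2 else 0) P := by
    intro a
    split_ifs
    · exact hint a
    · exact integrable_zero _ _ _
  have htr : Integrable (fun ω => (W ω ^ m).trace) P := by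
    simp only [trace_pow_eq_sum_walk]
    exact integrable_finsetSum _ fun a _ => hint' a
  have hle : ∫ ω, RCLike.re (W ω ^ m).trace ∂P ≤ M := by
    rw [integral_re htr]
    refine (RCLike.re_le_norm _).trans (le_trans ?_ hM)
    simp only [trace_pow_eq_sum_walk]
    rw [integral_finsetSum _ fun a _ => hint' a]
    refine (norm_sum_le _ _).trans (Finset.sum_le_sum fun a _ => ?_)
    -- Walks that do not close up contribute zero to the trace, so the sum over all walks is an
    -- upper bound.
    split_ifs
    · rfl
    · simp
  have hmk := mul_meas_ge_le_integral_of_nonneg (μ := P)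
    (f := fun ω => RCLike.re (W ω ^ m).trace)
    (Filter.Eventually.of_forall fun ω =>
      (pow_nonneg (norm_nonneg _) _).trans (opNorm_pow_le_re_trace (hW ω) n)) htr.re (t ^ m)
  rw [le_div_iff₀ (by positivity), mul_comm]
  refine le_trans (mul_le_mul_of_nonneg_left ?_ (by positivity)) (hmk.trans hle)
  refine measureReal_mono fun ω hω => ?_
  exact (pow_le_pow_left₀ ht.le (le_of_lt hω) m).trans (opNorm_pow_le_re_trace (hW ω) n)

/-- The constant in the tree bound for `k`-cumulants. -/
noncomputable def treeConst (Cκ : ℝ) (C : ℕ → ℝ) (k : ℕ) : ℝ :=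
  max 1 (C k) * max 1 Cκ ^ (k * k)

lemma treeConst_nonneg (Cκ : ℝ) (C : ℕ → ℝ) (k : ℕ) : 0 ≤ treeConst Cκ C k := by
  unfold treeConst; positivity

lemma tree_bound {N k : ℕ} {Cκ s : ℝ} (C : ℕ → ℝ) (T : SimpleGraph (Fin k))
    (α : Fin k → Fin N × Fin N) {x : Fin k × Fin k → ℝ} (hx : ∀ e, 0 ≤ x e)
    (hxle : ∀ e, x e ≤ Cκ / (1 + pairDist (α e.1) (α e.2) ^ s)) {y : ℝ}
    (hy : y ≤ C k * ∏ e ∈ edges T, x e) :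
    y ≤ treeConst Cκ C k * ∏ e ∈ edges T, pairWeight s (α e.1) (α e.2) := by
  have hprod : ∏ e ∈ edges T, x e ≤
      max 1 Cκ ^ (k * k) * ∏ e ∈ edges T, pairWeight s (α e.1) (α e.2) := by
    calc ∏ e ∈ edges T, x e ≤ ∏ e ∈ edges T, max 1 Cκ * pairWeight s (α e.1) (α e.2) := by
          refine Finset.prod_le_prod (fun e _ => hx e) fun e _ => (hxle e).trans ?_
          rw [div_eq_mul_inv]
          exact mul_le_mul_of_nonneg_right (le_max_right _ _) (pairWeight_nonneg s _ _)
      _ = max 1 Cκ ^ (edges T).card * ∏ e ∈ edges T, pairWeight s (α e.1) (α e.2) := by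
          rw [Finset.prod_mul_distrib, Finset.prod_const]
      -- The edges are among the `k * k` ordered pairs, and the base is at least `1`.
      _ ≤ _ := by
          refine mul_le_mul_of_nonneg_right (pow_le_pow_right₀ (le_max_left _ _) ?_)
            (Finset.prod_nonneg fun e _ => pairWeight_nonneg s _ _)
          simpa using Finset.card_le_univ (edges T)
  rw [treeConst, mul_assoc]
  exact hy.trans (mul_le_mul (le_max_right _ _) hprod (Finset.prod_nonneg fun e _ => hx e)
    (by positivity))

lemma edges_top_two : edges (⊤ : SimpleGraph (Fin 2)) = {(0, 1)} := by
  ext ⟨i, j⟩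
  fin_cases i <;> fin_cases j <;> simp [edges]

/-- On two vertices the tree is a single edge; this puts second cumulants in the same form as the
higher ones. -/
lemma pair_bound {N : ℕ} {Cκ s : ℝ} (C : ℕ → ℝ) (α : Fin 2 → Fin N × Fin N) {y : ℝ}
    (hy : y ≤ Cκ / (1 + pairDist (α 0) (α 1) ^ s)) :
    y ≤ treeConst Cκ C 2 *
      ∏ e ∈ edges (⊤ : SimpleGraph (Fin 2)), pairWeight s (α e.1) (α e.2) := by
  rw [edges_top_two, Finset.prod_singleton]
  refine hy.trans ?_
  rw [div_eq_mul_inv]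
  refine mul_le_mul_of_nonneg_right ?_ (pairWeight_nonneg s _ _)
  calc Cκ ≤ max 1 Cκ := le_max_right _ _
    _ ≤ max 1 Cκ ^ (2 * 2) := le_self_pow₀ (le_max_left _ _) (by norm_num)
    _ ≤ _ := le_mul_of_one_le_left (by positivity) (le_max_left _ _)

/-! ### The real symmetric case. -/

section Real

variable {Ω : Type*} [MeasurableSpace Ω] {N : ℕ} {μ : ℕ → ℝ} {s Cκ : ℝ} {C : ℕ → ℝ}
  {P : Measure Ω} {W : Ω → Matrix (Fin N) (Fin N) ℝ}

lemma IsRealModel.cumulant_le (h : IsRealModel μ s Cκ C P W) (k : ℕ) (hk : 2 ≤ k)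
    (α : Fin k → Fin N × Fin N) : ∃ T : SimpleGraph (Fin k), T.Connected ∧
      ‖cumulant P (realEntries W) α‖ ≤
        treeConst Cκ C k * ∏ e ∈ edges T, pairWeight s (α e.1) (α e.2) := by
  rcases hk.eq_or_lt with rfl | hk
  · refine ⟨⊤, SimpleGraph.connected_top, pair_bound C α ?_⟩
    have := h.decay_two (α 0) (α 1)
    rwa [show ![α 0, α 1] = α from (List.ofFn_inj.1 (by simp))] at this
  · obtain ⟨T, hT, hle⟩ := h.decay_higher k hk α
    exact ⟨T, hT.1.connected, tree_bound C T α (fun _ => norm_nonneg _)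
      (fun e => h.decay_two (α e.1) (α e.2)) hle⟩

theorem IsRealModel.measureReal_lt_opNorm_le [IsProbabilityMeasure P] (hN : 1 ≤ N) (hs : 2 < s)
    (h : IsRealModel μ s Cκ C P W) (n : ℕ) {t : ℝ} (ht : 0 < t) :
    P.real {ω | t < opNorm (W ω)} ≤
      walkConst (treeConst Cκ C) s (2 * 2 ^ n) * (N : ℝ) ^ (2 ^ n + 1) / t ^ (2 * 2 ^ n) := by
  have hw : ∀ i, Measurable (realEntries W i) := fun i => h.measurable i.1 i.2
  have hL : ∀ i, ∀ q : ℕ, MemLp (realEntries W i) q P := fun i =>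
    memLp_of_integrable_pow (hw i) fun q => (h.moments q i.1 i.2).1
  refine CorrelatedMatrix.measureReal_lt_opNorm_le (fun ω => ?_) n (fun a => ?_) ?_ ht
  · rw [Matrix.IsHermitian, Matrix.conjTranspose_eq_transpose_of_trivial]
    exact h.symmetric ω
  · exact integrable_prod_of_memLp Finset.univ (f := fun l => realEntries W (step a l))
      fun l => hL _
  · exact sum_abs_integral_walk_le hN hw hL (fun i => h.centred i.1 i.2) id
      (treeConst_nonneg Cκ C) hs h.cumulant_le step fun _ _ => rfl

end Real

/-! ### The complex Hermitian case. -/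

section Hermitian

variable {Ω : Type*} [MeasurableSpace Ω] {N : ℕ} {μ : ℕ → ℝ} {s Cκ : ℝ} {C : ℕ → ℝ}
  {P : Measure Ω} {W : Ω → Matrix (Fin N) (Fin N) ℂ}

lemma norm_cumulant_le_complexCov (α β : Fin N × Fin N) (σ τ : Bool) :
    ‖cumulant P (complexEntries W) ![(α, σ), (β, τ)]‖ ≤ complexCov P W α β :=
  Finset.le_sup' (fun p : Bool × Bool =>
    ‖cumulant P (complexEntries W) ![(α, p.1), (β, p.2)]‖) (Finset.mem_univ (σ, τ))

lemma complexCov_nonneg (α β : Fin N × Fin N) : 0 ≤ complexCov P W α β :=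
  (norm_nonneg _).trans (norm_cumulant_le_complexCov α β false false)

lemma IsHermitianModel.cumulant_le (h : IsHermitianModel μ s Cκ C P W) (k : ℕ) (hk : 2 ≤ k)
    (α : Fin k → (Fin N × Fin N) × Bool) : ∃ T : SimpleGraph (Fin k), T.Connected ∧
      ‖cumulant P (complexEntries W) α‖ ≤
        treeConst Cκ C k * ∏ e ∈ edges T, pairWeight s (α e.1).1 (α e.2).1 := by
  rcases hk.eq_or_lt with rfl | hk
  · refine ⟨⊤, SimpleGraph.connected_top, pair_bound C (fun j => (α j).1) ?_⟩
    have := (norm_cumulant_le_complexCov (α 0).1 (α 1).1 (α 0).2 (α 1).2).trans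
      (h.decay_two (α 0).1 (α 1).1)
    rwa [show ![((α 0).1, (α 0).2), ((α 1).1, (α 1).2)] = α from (List.ofFn_inj.1 (by simp))]
      at this
  · obtain ⟨T, hT, hle⟩ := h.decay_higher k hk (fun j => (α j).1) fun j => (α j).2
    exact ⟨T, hT.1.connected, tree_bound C T (fun j => (α j).1)
      (fun e => complexCov_nonneg (α e.1).1 (α e.2).1)
      (fun e => h.decay_two (α e.1).1 (α e.2).1) hle⟩

omit [MeasurableSpace Ω] in
-- Writing each entry as real part plus `I` times imaginary part and multiplying out reduces a
-- complex mixed moment to `2 ^ m` real ones.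
lemma prod_eq_sum_complexEntries {m : ℕ} (b : Fin m → Fin N × Fin N) (ω : Ω) :
    ∏ l, W ω (b l).1 (b l).2 = ∑ σ : Fin m → Bool, (∏ l, if σ l then Complex.I else 1) *
      ((∏ l, complexEntries W (b l, σ l) ω : ℝ) : ℂ) := by
  have h : ∀ l, W ω (b l).1 (b l).2 = ∑ τ : Bool,
      (if τ then Complex.I else 1) * (complexEntries W (b l, τ) ω : ℂ) := by
    intro l
    simp only [Fintype.sum_bool, complexEntries]
    simp only [if_true, Bool.false_eq_true, if_false, one_mul]
    rw [add_comm, mul_comm, Complex.re_add_im]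
  simp only [h, Complex.ofReal_prod, ← Finset.prod_mul_distrib]
  rw [Finset.prod_univ_sum, Fintype.piFinset_univ]

theorem IsHermitianModel.measureReal_lt_opNorm_le [IsProbabilityMeasure P] (hN : 1 ≤ N)
    (hs : 2 < s) (h : IsHermitianModel μ s Cκ C P W) (n : ℕ) {t : ℝ} (ht : 0 < t) :
    P.real {ω | t < opNorm (W ω)} ≤ 2 ^ (2 * 2 ^ n) *
      (walkConst (treeConst Cκ C) s (2 * 2 ^ n) * (N : ℝ) ^ (2 ^ n + 1)) / t ^ (2 * 2 ^ n) := by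
  have hw : ∀ i, Measurable (complexEntries W i) := by
    rintro ⟨i, σ⟩
    have := h.measurable i.1 i.2
    cases σ
    · exact Complex.measurable_re.comp this
    · exact Complex.measurable_im.comp this
  have hle : ∀ i ω, |complexEntries W i ω| ≤ ‖W ω i.1.1 i.1.2‖ := by
    rintro ⟨i, σ⟩ ω
    cases σ
    · exact Complex.abs_re_le_norm _
    · exact Complex.abs_im_le_norm _
  have hL : ∀ i, ∀ q : ℕ, MemLp (complexEntries W i) q P := fun i =>
    memLp_of_integrable_pow (hw i) fun q => by
      refine (h.moments q i.1.1 i.1.2).1.mono'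
        ((hw i).abs.pow_const q).aestronglyMeasurable (Filter.Eventually.of_forall fun ω => ?_)
      rw [Real.norm_of_nonneg (by positivity)]
      exact pow_le_pow_left₀ (abs_nonneg _) (hle i ω) q
  have h0 : ∀ i, ∫ ω, complexEntries W i ω ∂P = 0 := by
    rintro ⟨i, σ⟩
    have hi : Integrable (fun ω => W ω i.1 i.2) P := by
      rw [← integrable_norm_iff (h.measurable i.1 i.2).aestronglyMeasurable]
      simpa using (h.moments 1 i.1 i.2).1
    cases σ
    · have := integral_re hi
      rw [h.centred] at this
      simpa [complexEntries] using this
    · have := integral_im hi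
      rw [h.centred] at this
      simpa [complexEntries] using this
  have hint : ∀ {m : ℕ} (b : Fin m → Fin N × Fin N) (σ : Fin m → Bool),
      Integrable (fun ω => (∏ l, if σ l then Complex.I else 1) *
        ((∏ l, complexEntries W (b l, σ l) ω : ℝ) : ℂ)) P := fun b σ =>
    (integrable_prod_of_memLp Finset.univ (f := fun l => complexEntries W (b l, σ l))
      fun l => hL _).ofReal.const_mul _
  refine CorrelatedMatrix.measureReal_lt_opNorm_le h.hermitian n (fun a => ?_) ?_ ht
  · simp only [prod_eq_sum_complexEntries (step a)]
    exact integrable_finsetSum _ fun σ _ => hint _ σ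
  · calc ∑ a : Fin (2 * 2 ^ n + 1) → Fin N, ‖∫ ω, ∏ l, W ω (step a l).1 (step a l).2 ∂P‖
        ≤ ∑ a : Fin (2 * 2 ^ n + 1) → Fin N, ∑ σ : Fin (2 * 2 ^ n) → Bool,
          |∫ ω, ∏ l, complexEntries W (step a l, σ l) ω ∂P| := by
          refine Finset.sum_le_sum fun a _ => ?_
          simp only [prod_eq_sum_complexEntries (step a)]
          rw [integral_finsetSum _ fun σ _ => hint _ σ]
          refine (norm_sum_le _ _).trans_eq (Finset.sum_congr rfl fun σ _ => ?_)
          rw [integral_const_mul, norm_mul, norm_prod, integral_complex_ofReal, Complex.norm_real,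
            Real.norm_eq_abs]
          -- Each coefficient is a product of factors `1` and `I`, hence of modulus one.
          rw [Finset.prod_eq_one, one_mul]
          intro l _
          split_ifs <;> simp
      _ = ∑ σ : Fin (2 * 2 ^ n) → Bool, ∑ a : Fin (2 * 2 ^ n + 1) → Fin N,
          |∫ ω, ∏ l, complexEntries W (step a l, σ l) ω ∂P| := Finset.sum_comm
      _ ≤ ∑ _σ : Fin (2 * 2 ^ n) → Bool,
          walkConst (treeConst Cκ C) s (2 * 2 ^ n) * (N : ℝ) ^ (2 ^ n + 1) :=
          Finset.sum_le_sum fun σ _ => sum_abs_integral_walk_le hN hw hL h0 Prod.fst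
            (treeConst_nonneg Cκ C) hs h.cumulant_le (fun a l => (step a l, σ l)) fun _ _ => rfl
      _ = _ := by simp

end Hermitian

/-! ### Rescaling and choice of the moment. -/

lemma setOf_lt_opNorm_smul {𝕜 Ω : Type*} [RCLike 𝕜] {N : ℕ} (hN : 1 ≤ N)
    (W : Ω → Matrix (Fin N) (Fin N) 𝕜) (x : ℝ) :
    {ω | x < opNorm ((1 / √(N : ℝ)) • W ω)} = {ω | x * √(N : ℝ) < opNorm (W ω)} := by
  have hN' : 0 < √(N : ℝ) := Real.sqrt_pos.2 (by exact_mod_cast hN)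
  ext ω
  rw [Set.mem_ofPred_eq, Set.mem_ofPred_eq, opNorm_smul, abs_of_pos (by positivity),
    one_div_mul_eq_div, lt_div_iff₀ hN']

/-- The factor `√N ^ (2p) = N ^ p` cancels all but one power of `N`, leaving `N ^ (1 - 2pε)`; hence
the condition on `p`. -/
lemma moment_bound_le_rpow {N : ℕ} (hN : 1 ≤ N) {ε D K : ℝ} {p : ℕ} (hK : 0 ≤ K)
    (hp : D + 1 ≤ ε * (2 * p)) :
    K * (N : ℝ) ^ (p + 1) / ((N : ℝ) ^ ε * √(N : ℝ)) ^ (2 * p) ≤ K * (N : ℝ) ^ (-D) := by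
  have hN1 : (1 : ℝ) ≤ N := by exact_mod_cast hN
  have hN0 : (0 : ℝ) < N := by linarith
  have h1 : ((N : ℝ) ^ ε * √(N : ℝ)) ^ (2 * p) = (N : ℝ) ^ (ε * (2 * p)) * (N : ℝ) ^ p := by
    rw [mul_pow, pow_mul (√(N : ℝ)), Real.sq_sqrt hN0.le, ← Real.rpow_mul_natCast hN0.le]
    push_cast
    rfl
  rw [h1, pow_succ, mul_div_assoc]
  refine mul_le_mul_of_nonneg_left ?_ hK
  rw [mul_comm ((N : ℝ) ^ p), mul_div_mul_right _ _ (pow_pos hN0 p).ne']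
  calc (N : ℝ) / (N : ℝ) ^ (ε * (2 * p)) = (N : ℝ) ^ (1 - ε * (2 * p)) := by
        rw [Real.rpow_sub hN0, Real.rpow_one]
    _ ≤ (N : ℝ) ^ (-D) := Real.rpow_le_rpow_of_exponent_le hN1 (by linarith)

end CorrelatedMatrix

theorem theorem1 (μ : ℕ → ℝ) (s Cκ : ℝ) (C : ℕ → ℝ)
    (hs : 2 < s) (hCκ : 0 < Cκ) (hC : ∀ k, 0 < C k)
    (ε D : ℝ) (hε : 0 < ε) (hD : 0 < D) :
    ∃ K : ℝ,
      (∀ N : ℕ, 1 ≤ N → ∀ (Ω : Type*) [MeasurableSpace Ω] (P : Measure Ω) [IsProbabilityMeasure P]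
        (W : Ω → Matrix (Fin N) (Fin N) ℝ), CorrelatedMatrix.IsRealModel μ s Cκ C P W →
        P.real {ω | (N : ℝ) ^ ε < CorrelatedMatrix.opNorm ((1 / √(N : ℝ)) • W ω)}
          ≤ K * (N : ℝ) ^ (-D)) ∧
      (∀ N : ℕ, 1 ≤ N → ∀ (Ω : Type*) [MeasurableSpace Ω] (P : Measure Ω) [IsProbabilityMeasure P]
        (W : Ω → Matrix (Fin N) (Fin N) ℂ), CorrelatedMatrix.IsHermitianModel μ s Cκ C P W →
        P.real {ω | (N : ℝ) ^ ε < CorrelatedMatrix.opNorm ((1 / √(N : ℝ)) • W ω)}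
          ≤ K * (N : ℝ) ^ (-D)) := by
  obtain ⟨n, hn⟩ : ∃ n : ℕ, D + 1 ≤ ε * (2 * (2 ^ n : ℕ)) := by
    obtain ⟨n, hn⟩ := pow_unbounded_of_one_lt ((D + 1) / (ε * 2)) (one_lt_two (α := ℝ))
    refine ⟨n, ?_⟩
    rw [div_lt_iff₀ (by positivity)] at hn
    push_cast
    linarith
  set A := CorrelatedMatrix.walkConst (CorrelatedMatrix.treeConst Cκ C) s (2 * 2 ^ n)
  have hA0 : 0 ≤ A := CorrelatedMatrix.walkConst_nonneg (CorrelatedMatrix.treeConst_nonneg Cκ C) s _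
  -- The factor `2 ^ (2 * 2 ^ n)` counts the choices of real or imaginary part along a walk; in the
  -- real case it only weakens the bound.
  refine ⟨2 ^ (2 * 2 ^ n) * A, fun N hN Ω _ P _ W h => ?_, fun N hN Ω _ P _ W h => ?_⟩
  all_goals
    have hN0 : (0 : ℝ) < N := by exact_mod_cast hN
    have ht : 0 < (N : ℝ) ^ ε * √(N : ℝ) := by positivity
    rw [CorrelatedMatrix.setOf_lt_opNorm_smul hN]
  · refine (h.measureReal_lt_opNorm_le hN hs n ht).trans
      ((CorrelatedMatrix.moment_bound_le_rpow hN hA0 hn).trans ?_)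
    gcongr
    exact le_mul_of_one_le_left hA0 (one_le_pow₀ one_le_two)
  · refine (h.measureReal_lt_opNorm_le hN hs n ht).trans ?_
    rw [← mul_assoc]
    exact CorrelatedMatrix.moment_bound_le_rpow hN (by positivity) hn
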